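/- Let $\mathcal{O}=\mathcal{O}_{\mathbb{C}^2,0}$ be the ring of germs at the origin of holomorphic functions on $\mathbb{C}^2$, with coordinates $(x,y)$, and let $\mathcal{G}$ be a germ of foliation on $(\mathbb{C}^2,0)$, defined by a germ of holomorphic 1-form $\eta = a\,dx + b\,dy$ whose coefficients $a,b\in\mathcal{O}$ have no common factor (every common divisor of $a$ and $b$ in $\mathcal{O}$ is a unit; $\mathcal{G}$ may be regular or singular at the origin). Write $d\eta = f\,dx\wedge dy$ with $f = \frac{\partial b}{\partial x}-\frac{\partial a}{\partial y}$, and put \[ J(\eta) = (a,b),\qquad J(\eta,d\eta) = (a,b,f),\qquad I(\eta) = \{\,h\in\mathcal{O} \mid h\,d\eta = \eta\wedge\theta \text{ for some germ of holomorphic 1-form } \theta\,\}. \] Then $I(\eta)$ is an ideal of $\mathcal{O}$ containing $J(\eta)$. Let $U(\mathcal{G}) = I(\eta)/J(\eta)$ be Suwa's space of first-order unfoldings, and let $\delta(\mathcal{G},0) = \ell\left(\mathcal{O}/J(\eta,d\eta)\right)$, where $\ell$ denotes the length of an $\mathcal{O}$-module. Then $\delta(\mathcal{G},0)$ is finite,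 $\delta(\mathcal{G},0) = \dim_{\mathbb{C}} \mathcal{O}/J(\eta,d\eta)$, and \[ \ell(U(\mathcal{G})) = \dim_{\mathbb{C}} U(\mathcal{G}) = \delta(\mathcal{G},0). \] -/

import Mathlib

open Filter Topology

noncomputable section

namespace PlaneFoliation

/-- Germs of `ℂ`-valued functions form a `ℂ`-algebra, for Mathlib's scalar multiplication. -/
instance germAlgebra {α : Type*} (l : Filter α) : Algebra ℂ (Germ l ℂ) :=
  Algebra.ofModule
    (fun c x y => Germ.inductionOn₂ x y fun f g =>
      congrArg Germ.ofFun (smul_mul_assoc c f g))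
    (fun c x y => Germ.inductionOn₂ x y fun f g =>
      congrArg Germ.ofFun (mul_smul_comm c f g))

/-- The germs at the origin of `ℂ²` that have a representative which is analytic (that is,
holomorphic near the origin), as a subalgebra of the algebra of germs of all functions. -/
def holomorphicGerms : Subalgebra ℂ (Germ (𝓝 (0 : ℂ × ℂ)) ℂ) where
  carrier := {g | ∃ F : ℂ × ℂ → ℂ, AnalyticAt ℂ F 0 ∧ (F : Germ (𝓝 (0 : ℂ × ℂ)) ℂ) = g}
  mul_mem' := by
    rintro _ _ ⟨F, hF, rfl⟩ ⟨G, hG, rfl⟩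
    exact ⟨F * G, hF.mul hG, rfl⟩
  add_mem' := by
    rintro _ _ ⟨F, hF, rfl⟩ ⟨G, hG, rfl⟩
    exact ⟨F + G, hF.add hG, rfl⟩
  algebraMap_mem' := by
    intro c
    refine ⟨fun _ => c, analyticAt_const, ?_⟩
    rw [Algebra.algebraMap_eq_smul_one]
    refine congrArg Germ.ofFun (funext fun _ => ?_)
    simp

/-- The local ring `𝒪_{ℂ²,0}` of germs of holomorphic functions. -/
def 𝒪 : Type := holomorphicGerms

instance : CommRing 𝒪 := inferInstanceAs (CommRing holomorphicGerms)

instance : Algebra ℂ 𝒪 := inferInstanceAs (Algebra ℂ holomorphicGerms)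

/-- The germ of holomorphic function represented by a function analytic at the origin. -/
def germOf (F : ℂ × ℂ → ℂ) (hF : AnalyticAt ℂ F 0) : 𝒪 := ⟨(F : Germ _ ℂ), F, hF, rfl⟩

/-- The derivative of a germ of holomorphic function in the direction `v`. -/
def dirDeriv (v : ℂ × ℂ) (g : 𝒪) : 𝒪 :=
  ⟨Germ.map' (fun F p => fderiv ℂ F p v)
      (fun _ _ h => (Filter.EventuallyEq.fderiv h).mono fun p hp => by
        show fderiv ℂ _ p v = fderiv ℂ _ p v
        rw [hp]) g.1, by
    obtain ⟨_, F, hF, rfl⟩ := g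
    exact ⟨fun p => fderiv ℂ F p v,
      ((ContinuousLinearMap.apply ℂ ℂ v).analyticAt _).comp hF.fderiv, rfl⟩⟩

/-- `∂/∂x`, for the coordinates `(x, y)` of `ℂ²`. -/
def dX (g : 𝒪) : 𝒪 := dirDeriv (1, 0) g

/-- `∂/∂y`, for the coordinates `(x, y)` of `ℂ²`. -/
def dY (g : 𝒪) : 𝒪 := dirDeriv (0, 1) g

/-- The germ of holomorphic 1-form `a dx + b dy` on `(ℂ², 0)`. -/
structure OneForm where
  /-- the coefficient of `dx` -/
  a : 𝒪
  /-- the coefficient of `dy` -/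
  b : 𝒪

/-- The germ of holomorphic 2-form `f dx ∧ dy` on `(ℂ², 0)`. -/
@[ext] structure TwoForm where
  /-- the coefficient of `dx ∧ dy` -/
  f : 𝒪

/-- Multiplication of a 2-form by a function. -/
instance : SMul 𝒪 TwoForm := ⟨fun h ω => ⟨h * ω.f⟩⟩

/-- `(a dx + b dy) ∧ (a' dx + b' dy) = (a b' - b a') dx ∧ dy`. -/
def OneForm.wedge (η θ : OneForm) : TwoForm := ⟨η.a * θ.b - η.b * θ.a⟩

/-- `d(a dx + b dy) = (∂b/∂x - ∂a/∂y) dx ∧ dy`. -/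
def OneForm.d (η : OneForm) : TwoForm := ⟨dX η.b - dY η.a⟩

/-- `η` defines a germ of foliation on `(ℂ², 0)` when its coefficients have no common factor in
`𝒪`, that is, when its zero locus has codimension at least two. (On a surface `η ∧ dη = 0`
holds for every `η`.) The form may or may not vanish at the origin. -/
def OneForm.DefinesFoliation (η : OneForm) : Prop := IsRelPrime η.a η.b

/-- `J(η)`: the ideal generated by the coefficients of `η`. -/
def idealJ (η : OneForm) : Ideal 𝒪 := Ideal.span {η.a, η.b}

/-- `J(η, dη)`: the ideal generated by the coefficients of `η` and of `dη`. -/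
def idealJd (η : OneForm) : Ideal 𝒪 := Ideal.span {η.a, η.b, η.d.f}

/-- `I(η)`: the ideal of all `h ∈ 𝒪` with `h dη = η ∧ θ` for some germ of holomorphic
1-form `θ`. -/
def idealI (η : OneForm) : Ideal 𝒪 where
  carrier := {h | ∃ θ : OneForm, h • η.d = η.wedge θ}
  add_mem' := by
    rintro h k ⟨θ, hθ⟩ ⟨τ, hτ⟩
    refine ⟨⟨θ.a + τ.a, θ.b + τ.b⟩, TwoForm.ext ?_⟩
    have h1 : h * η.d.f = η.a * θ.b - η.b * θ.a := congrArg TwoForm.f hθ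
    have h2 : k * η.d.f = η.a * τ.b - η.b * τ.a := congrArg TwoForm.f hτ
    show (h + k) * η.d.f = η.a * (θ.b + τ.b) - η.b * (θ.a + τ.a)
    linear_combination h1 + h2
  zero_mem' := by
    refine ⟨⟨0, 0⟩, TwoForm.ext ?_⟩
    show 0 * η.d.f = η.a * 0 - η.b * 0
    ring
  smul_mem' := by
    rintro c h ⟨θ, hθ⟩
    refine ⟨⟨c * θ.a, c * θ.b⟩, TwoForm.ext ?_⟩
    have h1 : h * η.d.f = η.a * θ.b - η.b * θ.a := congrArg TwoForm.f hθ
    show (c * h) * η.d.f = η.a * (c * θ.b) - η.b * (c * θ.a)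
    linear_combination c * h1

/-- `J(η)` is contained in `I(η)`, so that the quotient `I(η)/J(η)` makes sense. -/
theorem idealJ_le_idealI (η : OneForm) : idealJ η ≤ idealI η := by
  refine Ideal.span_le.2 ?_
  rintro h (rfl | rfl)
  · refine ⟨⟨0, η.d.f⟩, TwoForm.ext ?_⟩
    show η.a * η.d.f = η.a * η.d.f - η.b * 0
    ring
  · refine ⟨⟨-η.d.f, 0⟩, TwoForm.ext ?_⟩
    show η.b * η.d.f = η.a * 0 - η.b * -η.d.f
    ring

/-- Suwa's space of first-order unfoldings `U = I(η)/J(η)`, as an `𝒪`-module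
(`(idealJ η).submoduleOf (idealI η)` is `J(η)` regarded as a submodule of `I(η)`). -/
abbrev Unfoldings (η : OneForm) : Type :=
  ↥(idealI η) ⧸ (idealJ η).submoduleOf (idealI η)

/-- The local invariant `δ`: the length of the `𝒪`-module `𝒪 / J(η, dη)`. -/
def delta (η : OneForm) : ℕ∞ := Module.length 𝒪 (𝒪 ⧸ idealJd η)

end PlaneFoliation

end

/-!
Write `J = (a, b)` and let `f` be the coefficient of `dη`. Unwinding the wedge product, `h ∈ I(η)`
means `h f ∈ J`. Hence `I(η)/J` is the kernel, and `𝒪/(a, b, f)` the cokernel, of multiplication by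
`f` on `𝒪/J`. Once `𝒪/J` is known to have finite dimension over `ℂ`, the two dimensions are finite
and equal (`finrank_colon_quotient`). Lengths agree with dimensions because a commutative algebra
over an algebraically closed field acts by scalars on a simple module of finite dimension
(`length_eq_finrank_of_isAlgClosed`).

There remains the local Bézout theorem: `𝒪/(a, b)` has finite dimension when `a` and `b` have no
common factor. It suffices that `J` contains a power of `x` and a power of `y`
(`exists_pow_mem_span_pair`). Let `I` be the ideal of all `h` with `xⁿ h ∈ J` for some `n`. Among its
elements choose `p` with `p(0, y)` of minimal order at `y = 0`. If `p` divides every element of `I`,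
then it divides `a` and `b`, so it is a unit and `1 ∈ I`, that is, `xⁿ ∈ J` for some `n`. Modulo `x`,
some element of `J` is a unit times a power of `y`, so `J` contains a power of `y` as well.

That `p` divides each `h ∈ I` (`dvd_of_orderY_minimal`) is clear for formal power series: by
minimality of the order `h = c(y) p + x h₁`, here `h₁` is again in `I`, and this can be repeated.
For convergence, the quotient is written down at once as a Cauchy integral of `h / p` over a circle
`|y| = s` on which `p(0, y)` has no zero; the difference between `h` and `p` times this integral is
divisible by every power of `x`, hence zero (`sub_mul_cauchyTransform_eq_pow_mul`). Joint analyticity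
in `(x, y)` of such integrals is obtained from functions of one variable by regarding a function of
`(x, y)` as an analytic curve, parametrized by `x`, in the Banach algebra of continuous functions on
the circle (`exists_analyticAt_curry`, `analyticAt_cauchyTransform`).
-/

/-! ### Length and dimension -/

/-- Schur's lemma over an algebraically closed field: a commutative algebra acts by scalars on a
simple module of finite dimension. -/
theorem finrank_eq_one_of_isSimpleModule {k R M : Type*} [Field k] [IsAlgClosed k] [CommRing R]
    [Algebra k R] [AddCommGroup M] [Module R M] [Module k M] [IsScalarTower k R M]
    [Module.Finite k M] [IsSimpleModule R M] : Module.finrank k M = 1 := by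
  have : Nontrivial M := IsSimpleModule.nontrivial R M
  have scalar (r : R) : ∃ c : k, ∀ m : M, r • m = c • m := by
    obtain ⟨c, hc⟩ := Module.End.exists_eigenvalue (Algebra.lsmul k k M r)
    obtain ⟨v, hv⟩ := hc.exists_hasEigenvector
    -- The kernel of `r - c` is an `R`-submodule, nonzero because `c` is an eigenvalue.
    let N : Submodule R M := LinearMap.ker (LinearMap.lsmul R M (r - algebraMap k R c))
    have mem (m : M) : m ∈ N ↔ r • m = c • m := by
      simp [N, sub_eq_zero, algebraMap_smul]
    have hN : N = ⊤ := by
      refine (eq_bot_or_eq_top N).resolve_left fun h => hv.2 ?_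
      have : v ∈ N := (mem v).2 hv.apply_eq_smul
      rwa [h, Submodule.mem_bot] at this
    exact ⟨c, fun m => (mem m).1 (hN ▸ Submodule.mem_top)⟩
  obtain ⟨v, hv⟩ := exists_ne (0 : M)
  refine finrank_eq_one v hv fun w => ?_
  have hw : w ∈ Submodule.span R {v} :=
    (IsSimpleModule.span_singleton_eq_top R hv) ▸ Submodule.mem_top
  obtain ⟨r, rfl⟩ := Submodule.mem_span_singleton.1 hw
  obtain ⟨c, hc⟩ := scalar r
  exact ⟨c, (hc v).symm⟩

/-- Over a commutative algebra over an algebraically closed field, the length of a module of finite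
dimension is its dimension. -/
theorem length_eq_finrank_of_isAlgClosed {k R M : Type*} [Field k] [IsAlgClosed k] [CommRing R]
    [Algebra k R] [AddCommGroup M] [Module R M] [Module k M] [IsScalarTower k R M]
    [Module.Finite k M] : Module.length R M = (Module.finrank k M : ℕ∞) := by
  induction hn : Module.finrank k M using Nat.strong_induction_on generalizing M with
  | _ n ih =>
  subst hn
  rcases subsingleton_or_nontrivial M with hM | hM
  · simp [Module.length_eq_zero, Module.finrank_zero_of_subsingleton]
  have : IsNoetherian R M := isNoetherian_of_tower k inferInstance
  obtain ⟨N, hN, -⟩ := (eq_top_or_exists_le_coatom (⊥ : Submodule R M)).resolve_left bot_ne_top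
  have : IsSimpleModule R (M ⧸ N) := isSimpleModule_iff_isCoatom.2 hN
  have h1 : Module.finrank k (M ⧸ N) = 1 := finrank_eq_one_of_isSimpleModule (R := R)
  have h2 : Module.finrank k (M ⧸ N) + Module.finrank k N = Module.finrank k M :=
    Submodule.finrank_quotient_add_finrank (N.restrictScalars k)
  have : Module.Finite k N := inferInstanceAs (Module.Finite k (N.restrictScalars k))
  rw [Module.length_eq_add_of_exact N.subtype N.mkQ N.subtype_injective N.mkQ_surjective
    (LinearMap.exact_subtype_mkQ N), ih _ (by omega) rfl, Module.length_eq_one, ← h2, h1]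
  push_cast
  ring

/-! ### The kernel and the cokernel of a multiplication -/

/-- The `k`-dimensions of `(J : f) / J` and of `R / (J + (f))` agree, being those of the kernel and
of the cokernel of multiplication by `f` on `R / J`. -/
theorem finrank_colon_quotient {k R : Type*} [Field k] [CommRing R] [Algebra k R] {I J K : Ideal R}
    {f : R} (hI : ∀ h, h ∈ I ↔ h * f ∈ J) (hK : K = J ⊔ Ideal.span {f})
    [Module.Finite k (R ⧸ J)] :
    Module.Finite k (R ⧸ K) ∧ Module.Finite k (↥I ⧸ J.submoduleOf I) ∧
      Module.finrank k (↥I ⧸ J.submoduleOf I) = Module.finrank k (R ⧸ K) := by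
  let μ : (R ⧸ J) →ₗ[R] (R ⧸ J) := LinearMap.lsmul R (R ⧸ J) f
  let α : I →ₗ[R] R ⧸ J := J.mkQ.comp (Submodule.subtype I)
  have hJK : J ≤ K := hK ▸ le_sup_left
  let β : (R ⧸ J) →ₗ[R] R ⧸ K := Submodule.factor hJK
  have hβ : Function.Surjective β := Submodule.factor_surjective hJK
  have zero (L : Ideal R) (h : R) : L.mkQ h = 0 ↔ h ∈ L := Submodule.Quotient.mk_eq_zero L
  have hα : LinearMap.ker α = J.submoduleOf I := by
    ext x
    exact zero J x
  have hαμ : LinearMap.range α = LinearMap.ker μ := by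
    ext x
    obtain ⟨h, rfl⟩ := J.mkQ_surjective x
    have h1 : J.mkQ h ∈ LinearMap.ker μ ↔ h ∈ I := by
      rw [hI, mul_comm]
      exact zero J (f * h)
    rw [h1]
    constructor
    · rintro ⟨⟨g, hg⟩, e⟩
      have e' : J.mkQ (h - g) = 0 := by rw [map_sub, sub_eq_zero]; exact e.symm
      have e2 : h - g ∈ J := (zero J _).1 e'
      have e3 : h - g ∈ I := (hI _).2 (J.mul_mem_right _ e2)
      simpa using I.add_mem e3 hg
    · exact fun hh => ⟨⟨h, hh⟩, rfl⟩
  have hμβ : LinearMap.range μ = LinearMap.ker β := by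
    ext x
    obtain ⟨h, rfl⟩ := J.mkQ_surjective x
    have h1 : J.mkQ h ∈ LinearMap.ker β ↔ h ∈ K := zero K h
    rw [h1, hK]
    constructor
    · rintro ⟨y, e⟩
      obtain ⟨g, rfl⟩ := J.mkQ_surjective y
      have e' : J.mkQ (f * g - h) = 0 := by rw [map_sub, sub_eq_zero]; exact e
      have e2 : f * g - h ∈ J := (zero J _).1 e'
      have : h = -(f * g - h) + f * g := by ring
      rw [this]
      exact Ideal.add_mem _ (Ideal.mem_sup_left (J.neg_mem e2))
        (Ideal.mem_sup_right (Ideal.mul_mem_right _ _ (Ideal.mem_span_singleton_self f)))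
    · intro hh
      obtain ⟨j, hj, y, hy, rfl⟩ := Submodule.mem_sup.1 hh
      obtain ⟨g, rfl⟩ := Ideal.mem_span_singleton'.1 hy
      refine ⟨J.mkQ g, ?_⟩
      have : J.mkQ j = 0 := (zero J j).2 hj
      rw [map_add, this, zero_add, mul_comm]
      rfl
  have fin : Module.Finite k (R ⧸ K) :=
    Module.Finite.of_surjective (β.restrictScalars k) hβ
  let e : (↥I ⧸ J.submoduleOf I) ≃ₗ[R] LinearMap.ker μ :=
    (Submodule.quotEquivOfEq _ _ hα.symm).trans
      (α.quotKerEquivRange.trans (LinearEquiv.ofEq _ _ hαμ))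
  let e' : (↥I ⧸ J.submoduleOf I) ≃ₗ[k] LinearMap.ker (μ.restrictScalars k) :=
    e.restrictScalars k
  have fin' : Module.Finite k (↥I ⧸ J.submoduleOf I) := Module.Finite.equiv e'.symm
  refine ⟨fin, fin', ?_⟩
  have n1 := LinearMap.finrank_range_add_finrank_ker (μ.restrictScalars k)
  have n2 := LinearMap.finrank_range_add_finrank_ker (β.restrictScalars k)
  have n3 : Module.finrank k (LinearMap.range (β.restrictScalars k)) =
      Module.finrank k (R ⧸ K) := by
    have : LinearMap.range (β.restrictScalars k) = ⊤ := LinearMap.range_eq_top.2 hβ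
    rw [this, finrank_top]
  have n4 : Module.finrank k (LinearMap.ker (β.restrictScalars k)) =
      Module.finrank k (LinearMap.range (μ.restrictScalars k)) := by
    have : LinearMap.ker (β.restrictScalars k) = LinearMap.range (μ.restrictScalars k) := by
      rw [LinearMap.ker_restrictScalars, ← hμβ, LinearMap.range_restrictScalars]
    rw [this]
  rw [e'.finrank_eq]
  omega

/-! ### Algebras generated by nilpotent elements -/

/-- A `k`-algebra with nilpotent elements `X`, `Y` such that every element is a constant modulo
`(X, Y)` has finite dimension. -/
theorem finite_of_isNilpotent {k A : Type*} [Field k] [CommRing A] [Algebra k A] {X Y : A}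
    (hX : IsNilpotent X) (hY : IsNilpotent Y)
    (H : ∀ h : A, ∃ (c : k) (h₁ h₂ : A), h = algebraMap k A c + X * h₁ + Y * h₂) :
    Module.Finite k A := by
  let S : Subalgebra k A := Algebra.adjoin k {X, Y}
  have integral {Z : A} (hZ : IsNilpotent Z) : IsIntegral k Z := by
    obtain ⟨n, hn⟩ := hZ
    exact ⟨Polynomial.X ^ n, Polynomial.monic_X_pow n, by simp [hn]⟩
  have hS : (Subalgebra.toSubmodule S).FG := by
    refine fg_adjoin_of_finite (by simp) ?_
    rintro z (rfl | rfl)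
    exacts [integral hX, integral hY]
  have mX : X ∈ S := Algebra.subset_adjoin (by simp)
  have mY : Y ∈ S := Algebra.subset_adjoin (by simp)
  let I : Ideal A := Ideal.span {X, Y}
  have approx (n : ℕ) : ∀ h : A, ∃ s ∈ S, h - s ∈ I ^ n := by
    induction n with
    | zero => exact fun h => ⟨0, S.zero_mem, by simp⟩
    | succ n ih =>
      intro h
      obtain ⟨c, h₁, h₂, rfl⟩ := H h
      obtain ⟨s₁, m₁, e₁⟩ := ih h₁
      obtain ⟨s₂, m₂, e₂⟩ := ih h₂
      refine ⟨algebraMap k A c + X * s₁ + Y * s₂, S.add_mem (S.add_mem (S.algebraMap_mem c)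
        (S.mul_mem mX m₁)) (S.mul_mem mY m₂), ?_⟩
      have : algebraMap k A c + X * h₁ + Y * h₂ - (algebraMap k A c + X * s₁ + Y * s₂) =
          X * (h₁ - s₁) + Y * (h₂ - s₂) := by ring
      rw [this, pow_succ']
      exact Ideal.add_mem _ (Ideal.mul_mem_mul (Ideal.subset_span (by simp)) e₁)
        (Ideal.mul_mem_mul (Ideal.subset_span (by simp)) e₂)
  obtain ⟨N, hN⟩ : IsNilpotent I := by
    refine (Ideal.FG.isNilpotent_iff_le_nilradical (Submodule.fg_span (by simp))).2 ?_
    refine Ideal.span_le.2 ?_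
    rintro z (rfl | rfl)
    exacts [hX, hY]
  have top : Subalgebra.toSubmodule S = ⊤ := by
    rw [eq_top_iff]
    intro h _
    obtain ⟨s, hs, e⟩ := approx N h
    rw [hN, Ideal.zero_eq_bot, Ideal.mem_bot, sub_eq_zero] at e
    exact e ▸ hs
  exact Module.finite_def.2 (top ▸ hS)

/-! ### Functions of two variables as curves in a Banach algebra -/

/-- A function of two variables that is analytic along `{x₀} × K`, with `K` compact, is near `x₀` a
curve in `C(K, ℂ)` analytic in the first variable: it equals its own Cauchy integral there. -/
theorem exists_analyticAt_curry {F : ℂ × ℂ → ℂ} {K : Set ℂ} [CompactSpace K] {x₀ : ℂ}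
    (hF : ∀ y ∈ K, AnalyticAt ℂ F (x₀, y)) :
    ∃ Φ : ℂ → C(K, ℂ), AnalyticAt ℂ Φ x₀ ∧ ∀ᶠ x in 𝓝 x₀, ∀ y : K, Φ x y = F (x, y) := by
  classical
  have hK : IsCompact K := isCompact_iff_compactSpace.2 inferInstance
  obtain ⟨U, V, hU, -, hxU, hKV, hUV⟩ := generalized_tube_lemma (isCompact_singleton (x := x₀)) hK
    (isOpen_analyticAt ℂ F) (by rintro ⟨x, y⟩ ⟨rfl, hy⟩; exact hF y hy)
  obtain ⟨R, hR, hRU⟩ := Metric.nhds_basis_closedBall.mem_iff.1 (hU.mem_nhds (hxU rfl))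
  have an (x : ℂ) (hx : x ∈ Metric.closedBall x₀ R) (y : ℂ) (hy : y ∈ K) :
      AnalyticAt ℂ F (x, y) := hUV ⟨hRU hx, hKV hy⟩
  -- The curve `x ↦ F (x, ·)`, continuous over the closed disc.
  let G : C(Metric.closedBall x₀ R, C(K, ℂ)) :=
    ContinuousMap.curry ⟨fun p => F (p.1, p.2), continuous_iff_continuousAt.2 fun p =>
      ContinuousAt.comp (f := fun p : Metric.closedBall x₀ R × K => ((p.1 : ℂ), (p.2 : ℂ)))
        (an p.1 p.1.2 p.2 p.2.2).continuousAt (by fun_prop)⟩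
  let Ψ : ℂ → C(K, ℂ) := fun x => if h : x ∈ Metric.closedBall x₀ R then G ⟨x, h⟩ else 0
  have hΨ (x : ℂ) (hx : x ∈ Metric.closedBall x₀ R) (y : K) : Ψ x y = F (x, y) := by
    simp only [Ψ, dif_pos hx]; rfl
  have cΨ : ContinuousOn Ψ (Metric.closedBall x₀ R) := by
    rw [continuousOn_iff_continuous_domRestrict]
    convert G.continuous using 1
    ext x : 1
    exact dif_pos x.2
  have iΨ : CircleIntegrable Ψ x₀ R :=
    (cΨ.mono Metric.sphere_subset_closedBall).circleIntegrable hR.le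
  let r : NNReal := ⟨R, hR.le⟩
  refine ⟨fun w => (2 * Real.pi * Complex.I : ℂ)⁻¹ • ∮ z in C(x₀, R), (z - w)⁻¹ • Ψ z,
    (hasFPowerSeriesOn_cauchy_integral (R := r) iΨ hR).analyticAt, ?_⟩
  filter_upwards [Metric.ball_mem_nhds x₀ hR] with w hw y
  have hint : CircleIntegrable (fun z => (z - w)⁻¹ • Ψ z) x₀ R := by
    refine ContinuousOn.circleIntegrable hR.le ?_
    refine ContinuousOn.smul (ContinuousOn.inv₀ (f := fun z => z - w) (by fun_prop) fun z hz => ?_)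
      (cΨ.mono Metric.sphere_subset_closedBall)
    rintro h
    rw [sub_eq_zero] at h
    subst h
    exact (Metric.mem_ball.1 hw).ne hz
  -- Evaluation at `y` commutes with the integral, which reduces to Cauchy's formula for `F (·, y)`.
  let ev : C(K, ℂ) →L[ℂ] ℂ := ContinuousMap.evalCLM ℂ y
  have key : ev (∮ z in C(x₀, R), (z - w)⁻¹ • Ψ z) = ∮ z in C(x₀, R), (z - w)⁻¹ • F (z, y) := by
    rw [circleIntegral, ← ev.intervalIntegral_comp_comm hint.out, circleIntegral]
    refine intervalIntegral.integral_congr fun θ _ => ?_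
    have hθ : circleMap x₀ R θ ∈ Metric.closedBall x₀ R :=
      circleMap_mem_closedBall x₀ hR.le θ
    simp [ev, hΨ _ hθ]
  have d : DifferentiableOn ℂ (fun z => F (z, y)) (Metric.closedBall x₀ R) := fun z hz =>
    ((an z hz y y.2).differentiableAt.comp (f := fun z : ℂ => (z, (y : ℂ))) z
      (by fun_prop)).differentiableWithinAt
  have := (d.mono Metric.closure_ball_subset_closedBall).diffContOnCl
    |>.two_pi_i_inv_smul_circleIntegral_sub_inv_smul hw
  rw [← this, ← key]
  rfl

/-- The functional `g ↦ (2πi)⁻¹ ∮ g(ζ) dζ` on continuous functions on a circle. -/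
noncomputable def circleFunctional (c : ℂ) (s : NNReal) : C(Metric.sphere c s, ℂ) →L[ℂ] ℂ :=
  LinearMap.mkContinuous
    { toFun := fun g => (2 * Real.pi * Complex.I : ℂ)⁻¹ • ∫ θ in (0 : ℝ)..2 * Real.pi,
        deriv (circleMap c s) θ • g ⟨circleMap c s θ, circleMap_mem_sphere c s.2 θ⟩
      map_add' := fun g h => by
        rw [← smul_add, ← intervalIntegral.integral_add]
        · simp [mul_add]
        all_goals
          refine Continuous.intervalIntegrable ?_ _ _
          simp only [deriv_circleMap]
          fun_prop
      map_smul' := fun a g => by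
        simp only [ContinuousMap.smul_apply, RingHom.id_apply, smul_comm _ a,
          intervalIntegral.integral_smul] }
    s (fun g => by
      have : ‖∫ θ in (0 : ℝ)..2 * Real.pi, deriv (circleMap c s) θ •
          g ⟨circleMap c s θ, circleMap_mem_sphere c s.2 θ⟩‖ ≤ s * ‖g‖ * |2 * Real.pi - 0| := by
        refine intervalIntegral.norm_integral_le_of_norm_le_const fun θ _ => ?_
        rw [norm_smul]
        gcongr
        · simp
        · exact g.norm_coe_le_norm _
      simp only [LinearMap.coe_mk, AddHom.coe_mk, norm_smul, norm_inv, norm_mul]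
      have pi := Real.pi_pos
      rw [sub_zero, abs_of_pos (by positivity)] at this
      simp only [Complex.norm_ofNat, Complex.norm_real, Complex.norm_I, mul_one, Real.norm_eq_abs,
        abs_of_pos pi]
      rw [inv_mul_le_iff₀ (by positivity)]
      linarith)

theorem circleFunctional_apply (c : ℂ) (s : NNReal) (g : C(Metric.sphere c s, ℂ)) :
    circleFunctional c s g = (2 * Real.pi * Complex.I : ℂ)⁻¹ • ∫ θ in (0 : ℝ)..2 * Real.pi,
      deriv (circleMap c s) θ • g ⟨circleMap c s θ, circleMap_mem_sphere c s.2 θ⟩ := rfl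

/-- The function `ζ ↦ ζ - y` on a circle. -/
def circleSub (c : ℂ) (s : NNReal) (y : ℂ) : C(Metric.sphere c s, ℂ) :=
  ⟨fun ζ => ζ - y, by fun_prop⟩

/-- The Cauchy integral `(2πi)⁻¹ ∮ g(ζ) / (ζ - y) dζ` of a continuous function on a circle. The
kernel is the inverse of `ζ - y` in the Banach algebra of continuous functions, whence its analytic
dependence on `y`; the value is `0` for `y` on the circle. -/
noncomputable def cauchyTransform (c : ℂ) (s : NNReal) (y : ℂ) :
    C(Metric.sphere c s, ℂ) →L[ℂ] ℂ :=
  (circleFunctional c s).comp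
    (ContinuousLinearMap.mul ℂ C(Metric.sphere c s, ℂ) (Ring.inverse (circleSub c s y)))

theorem isUnit_circleSub {c : ℂ} {s : NNReal} {y : ℂ} (hy : y ∈ Metric.ball c s) :
    IsUnit (circleSub c s y) := by
  rw [ContinuousMap.isUnit_iff_forall_ne_zero]
  rintro ⟨ζ, hζ⟩ h
  have h' : ζ - y = 0 := h
  rw [sub_eq_zero] at h'
  subst h'
  exact (Metric.mem_ball.1 hy).ne hζ

theorem inverse_circleSub_apply {c : ℂ} {s : NNReal} {y : ℂ} (hy : y ∈ Metric.ball c s)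
    (ζ : Metric.sphere c s) : Ring.inverse (circleSub c s y) ζ = ((ζ : ℂ) - y)⁻¹ := by
  have h := congrArg (fun g : C(Metric.sphere c s, ℂ) => g ζ)
    (Ring.inverse_mul_cancel _ (isUnit_circleSub hy))
  exact eq_inv_of_mul_eq_one_left h

theorem analyticAt_ringInverse_comp {A : Type*} [NormedRing A] [NormedAlgebra ℂ A]
    [CompleteSpace A] {Φ : ℂ → A} {x : ℂ} (hΦ : AnalyticAt ℂ Φ x) (hu : IsUnit (Φ x)) :
    AnalyticAt ℂ (fun x => Ring.inverse (Φ x)) x := by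
  obtain ⟨u, hu⟩ := hu
  refine AnalyticAt.comp (g := Ring.inverse) (f := Φ) ?_ hΦ
  rw [← hu]
  exact analyticAt_inverse u

/-- The Cauchy integral of an analytic curve of functions on a circle is jointly analytic in the
parameter of the curve and in the point inside the circle. -/
theorem analyticAt_cauchyTransform {c : ℂ} {s : NNReal} {Φ : ℂ → C(Metric.sphere c s, ℂ)}
    {x₀ y₀ : ℂ} (hΦ : AnalyticAt ℂ Φ x₀) (hy : y₀ ∈ Metric.ball c s) :
    AnalyticAt ℂ (fun p : ℂ × ℂ => cauchyTransform c s p.2 (Φ p.1)) (x₀, y₀) := by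
  have h1 : AnalyticAt ℂ (circleSub c s) y₀ := by
    have : circleSub c s = fun y => circleSub c s 0 - algebraMap ℂ C(Metric.sphere c s, ℂ) y := by
      ext y ζ
      simp [circleSub]
    rw [this]
    exact analyticAt_const.sub (
      (Algebra.linearMap ℂ C(Metric.sphere c s, ℂ)).toContinuousLinearMap.analyticAt y₀)
  have h2 : AnalyticAt ℂ (fun y => Ring.inverse (circleSub c s y)) y₀ :=
    analyticAt_ringInverse_comp h1 (isUnit_circleSub hy)
  have h3 : AnalyticAt ℂ (fun p : ℂ × ℂ => Ring.inverse (circleSub c s p.2)) (x₀, y₀) :=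
    AnalyticAt.comp (f := Prod.snd) (x := ((x₀, y₀) : ℂ × ℂ)) h2 analyticAt_snd
  have h4 : AnalyticAt ℂ (fun p : ℂ × ℂ => Φ p.1) (x₀, y₀) :=
    AnalyticAt.comp (f := Prod.fst) (x := ((x₀, y₀) : ℂ × ℂ)) hΦ analyticAt_fst
  exact ((circleFunctional c s).analyticAt _).comp (h3.mul h4)

/-- Cauchy's integral formula. -/
theorem cauchyTransform_eq {c : ℂ} {s : NNReal} {y : ℂ} (hy : y ∈ Metric.ball c s) {f : ℂ → ℂ}
    (hf : DifferentiableOn ℂ f (Metric.closedBall c s)) {g : C(Metric.sphere c s, ℂ)}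
    (hg : ∀ ζ : Metric.sphere c s, g ζ = f ζ) : cauchyTransform c s y g = f y := by
  rw [← (hf.mono Metric.closure_ball_subset_closedBall).diffContOnCl
    |>.two_pi_i_inv_smul_circleIntegral_sub_inv_smul hy, circleIntegral]
  have h (θ : ℝ) : (Ring.inverse (circleSub c s y) * g)
      ⟨circleMap c s θ, circleMap_mem_sphere c s.2 θ⟩ =
      (circleMap c s θ - y)⁻¹ • f (circleMap c s θ) := by
    rw [ContinuousMap.mul_apply, inverse_circleSub_apply hy, hg, smul_eq_mul]
  rw [cauchyTransform, ContinuousLinearMap.comp_apply, ContinuousLinearMap.mul_apply',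
    circleFunctional_apply]
  simp only [h]

/-- The difference quotient in the first variable of an analytic function of two variables is
analytic in both. -/
theorem analyticAt_dslope_fst {F : ℂ × ℂ → ℂ} {x₀ y₀ : ℂ} (hF : AnalyticAt ℂ F (x₀, y₀)) :
    AnalyticAt ℂ (fun p : ℂ × ℂ => dslope (fun x => F (x, p.2)) x₀ p.1) (x₀, y₀) := by
  have hev : ∀ᶠ y in 𝓝 y₀, AnalyticAt ℂ F (x₀, y) :=
    (Continuous.prodMk_right x₀).continuousAt.eventually hF.eventually_analyticAt
  obtain ⟨s', hs', hball⟩ := Metric.nhds_basis_closedBall.mem_iff.1 hev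
  lift s' to NNReal using hs'.le with s
  obtain ⟨Φ, hΦ, hΦF⟩ := exists_analyticAt_curry (K := Metric.sphere y₀ (s : ℝ))
    fun y hy => hball (Metric.sphere_subset_closedBall hy)
  have hd : AnalyticAt ℂ (dslope Φ x₀) x₀ := by
    obtain ⟨p, hp⟩ := hΦ
    exact ⟨_, hp.has_fpower_series_dslope_fslope⟩
  have hy₀ : y₀ ∈ Metric.ball y₀ (s : ℝ) := Metric.mem_ball_self hs'
  refine (analyticAt_cauchyTransform hd hy₀).congr ?_
  obtain ⟨U, V, hU, -, hxU, hKV, hUV⟩ := generalized_tube_lemma (isCompact_singleton (x := x₀))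
    (isCompact_closedBall y₀ (s : ℝ)) (isOpen_analyticAt ℂ F)
    (by rintro ⟨x, y⟩ ⟨rfl, hy⟩; exact hball hy)
  have near : ∀ᶠ x in 𝓝 x₀, ∀ y ∈ Metric.ball y₀ (s : ℝ),
      cauchyTransform y₀ s y (Φ x) = F (x, y) := by
    filter_upwards [hΦF, hU.mem_nhds (hxU rfl)] with x hx hxU y hy
    refine cauchyTransform_eq (f := fun y => F (x, y)) hy (fun z hz => ?_) hx
    exact ((hUV ⟨hxU, hKV hz⟩ : AnalyticAt ℂ F (x, z)).differentiableAt.comp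
      (f := fun z : ℂ => (x, z)) z (by fun_prop)).differentiableWithinAt
  have e : ∀ᶠ p : ℂ × ℂ in 𝓝 (x₀, y₀), p.2 ∈ Metric.ball y₀ (s : ℝ) :=
    continuous_snd.continuousAt.eventually (Metric.ball_mem_nhds y₀ hs')
  have e' : ∀ᶠ p : ℂ × ℂ in 𝓝 (x₀, y₀), ∀ y ∈ Metric.ball y₀ (s : ℝ),
      cauchyTransform y₀ s y (Φ p.1) = F (p.1, y) := 
    (continuous_fst.continuousAt : ContinuousAt Prod.fst (x₀, y₀)).eventually near
  filter_upwards [e, e'] with p hp hp'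
  have hgerm : (cauchyTransform y₀ s p.2 ∘ Φ) =ᶠ[𝓝 x₀] fun x => F (x, p.2) := by
    filter_upwards [near] with x hx using hx _ hp
  rw [← (cauchyTransform y₀ s p.2).dslope_comp Φ x₀ p.1 fun _ => hΦ.differentiableAt]
  rcases eq_or_ne p.1 x₀ with h | h
  · rw [h, dslope_same, dslope_same, hgerm.deriv_eq]
  · rw [dslope_of_ne _ h, dslope_of_ne _ h, slope, slope, hgerm.eq_of_nhds]
    simp only [Function.comp_apply, hp' _ hp]

/-! ### Functions of one and two variables near the origin -/

/-- A function analytic at the origin of `ℂ²` that is divisible by every power of `x` vanishes near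
the origin: so it does on each line through the origin. -/
theorem eventually_eq_zero_of_forall_pow_fst {F : ℂ × ℂ → ℂ} (hF : AnalyticAt ℂ F 0)
    (h : ∀ N : ℕ, ∃ W : ℂ × ℂ → ℂ, AnalyticAt ℂ W 0 ∧ ∀ᶠ q in 𝓝 0, F q = q.1 ^ N * W q) :
    ∀ᶠ q in 𝓝 0, F q = 0 := by
  obtain ⟨R, hR, hball⟩ := Metric.nhds_basis_ball.mem_iff.1 hF.eventually_analyticAt
  filter_upwards [Metric.ball_mem_nhds (0 : ℂ × ℂ) hR] with v hv
  let l : ℂ →L[ℂ] ℂ × ℂ := ContinuousLinearMap.toSpanSingleton ℂ v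
  have l0 : l 0 = 0 := map_zero l
  have l1 : l 1 = v := by simp [l]
  have an : AnalyticOnNhd ℂ (F ∘ l) (l ⁻¹' Metric.ball 0 R) := fun t ht =>
    AnalyticAt.comp (hball ht) (l.analyticAt t)
  have conv : IsPreconnected (l ⁻¹' Metric.ball (0 : ℂ × ℂ) R) :=
    ((convex_ball (0 : ℂ × ℂ) R).linear_preimage (l.toLinearMap.restrictScalars ℝ)).isPreconnected
  have mem0 : (0 : ℂ) ∈ l ⁻¹' Metric.ball (0 : ℂ × ℂ) R := by simpa [l0] using hR
  have mem1 : (1 : ℂ) ∈ l ⁻¹' Metric.ball (0 : ℂ × ℂ) R := by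
    rw [Set.mem_preimage, l1]; exact hv
  have top : analyticOrderAt (F ∘ l) 0 = ⊤ := by
    refine ENat.eq_top_iff_forall_ge.2 fun N => ?_
    rw [natCast_le_analyticOrderAt (an 0 mem0)]
    obtain ⟨W, hW, e⟩ := h N
    have tl : Tendsto l (𝓝 0) (𝓝 0) := by simpa [l0] using l.continuous.tendsto 0
    refine ⟨fun t => v.1 ^ N * W (l t), analyticAt_const.mul
      (AnalyticAt.comp (by rwa [l0]) (l.analyticAt 0)), ?_⟩
    filter_upwards [tl.eventually e] with t ht
    rw [Function.comp_apply, ht]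
    simp [l]
    ring
  have := an.eqOn_zero_of_preconnected_of_eventuallyEq_zero conv mem0
    (analyticOrderAt_eq_top.1 top) mem1
  simpa [l1] using this

/-- Division of functions of one variable: if `g` vanishes on a set `K` at most at the
origin, to an order not greater than that of `f`, then `g` divides `f` over `K`. -/
theorem exists_analytic_quotient {f g : ℂ → ℂ} {K : Set ℂ} (h0 : (0 : ℂ) ∈ K)
    (hf : ∀ y ∈ K, AnalyticAt ℂ f y)
    (hg : ∀ y ∈ K, AnalyticAt ℂ g y) (hg0 : ∀ y ∈ K, y ≠ 0 → g y ≠ 0)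
    (htop : analyticOrderAt g 0 ≠ ⊤) (hle : analyticOrderAt g 0 ≤ analyticOrderAt f 0) :
    ∃ c : ℂ → ℂ, (∀ y ∈ K, AnalyticAt ℂ c y) ∧ ∀ y ∈ K, f y = c y * g y := by
  classical
  obtain ⟨d, hd⟩ := ENat.ne_top_iff_exists.1 htop
  obtain ⟨u, hu, u0, eu⟩ := ((hg 0 h0).analyticOrderAt_eq_natCast).1 hd.symm
  obtain ⟨v, hv, ev⟩ := (natCast_le_analyticOrderAt (hf 0 h0)).1 (hd ▸ hle)
  have hu0 : ∀ᶠ y in 𝓝 0, u y ≠ 0 := hu.continuousAt.eventually_ne u0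
  let c : ℂ → ℂ := fun y => if y = 0 then v 0 / u 0 else f y / g y
  have key : ∀ᶠ y in 𝓝 0, c y = v y / u y ∧ f y = c y * g y := by
    filter_upwards [eu, ev, hu0] with y h1 h2 h3
    simp only [sub_zero, smul_eq_mul] at h1 h2
    have hc : c y = v y / u y := by
      rcases eq_or_ne y 0 with rfl | hy
      · simp [c]
      · have : y ^ d ≠ 0 := pow_ne_zero d hy
        simp only [c, if_neg hy, h1, h2]
        field_simp
    refine ⟨hc, ?_⟩
    rw [hc, h1, h2]
    field_simp
  refine ⟨c, fun y hy => ?_, fun y hy => ?_⟩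
  · rcases eq_or_ne y 0 with rfl | hy0
    · exact (hv.div hu u0).congr (key.mono fun y h => h.1.symm)
    · refine ((hf y hy).div (hg y hy) (hg0 y hy hy0)).congr ?_
      filter_upwards [isOpen_ne.mem_nhds hy0] with z hz
      simp [c, show z ≠ 0 from hz]
  · rcases eq_or_ne y 0 with rfl | hy0
    · exact key.self_of_nhds.2
    · have := hg0 y hy hy0
      simp only [c, if_neg hy0]
      field_simp

/-! ### Germs and their representatives -/

namespace PlaneFoliation

theorem germOf_eq_iff {F G : ℂ × ℂ → ℂ} {hF : AnalyticAt ℂ F 0} {hG : AnalyticAt ℂ G 0} :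
    germOf F hF = germOf G hG ↔ F =ᶠ[𝓝 0] G :=
  Subtype.ext_iff.trans Germ.coe_eq

theorem exists_germOf (h : 𝒪) : ∃ F hF, germOf F hF = h := by
  obtain ⟨_, F, hF, rfl⟩ := h
  exact ⟨F, hF, rfl⟩

theorem germOf_add {F G : ℂ × ℂ → ℂ} (hF : AnalyticAt ℂ F 0) (hG : AnalyticAt ℂ G 0) :
    germOf F hF + germOf G hG = germOf (fun q => F q + G q) (hF.add hG) := rfl

theorem germOf_mul {F G : ℂ × ℂ → ℂ} (hF : AnalyticAt ℂ F 0) (hG : AnalyticAt ℂ G 0) :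
    germOf F hF * germOf G hG = germOf (fun q => F q * G q) (hF.mul hG) := rfl

theorem germOf_zero : germOf (fun _ => 0) analyticAt_const = 0 := rfl

theorem germOf_one : germOf (fun _ => 1) analyticAt_const = 1 := rfl

theorem algebraMap_eq_germOf (c : ℂ) : algebraMap ℂ 𝒪 c = germOf (fun _ => c) analyticAt_const := by
  rw [Algebra.algebraMap_eq_smul_one]
  refine Subtype.ext (congrArg Germ.ofFun (funext fun _ => ?_))
  simp

/-- The coordinate germ `x`. -/
noncomputable def coordX : 𝒪 := germOf Prod.fst analyticAt_fst

/-- The germ `c(y)` of a function of the second coordinate. -/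
noncomputable def germSnd (c : ℂ → ℂ) (hc : AnalyticAt ℂ c 0) : 𝒪 :=
  germOf (fun q => c q.2) (AnalyticAt.comp (f := Prod.snd) (x := (0 : ℂ × ℂ)) hc analyticAt_snd)

/-- The coordinate germ `y`. -/
noncomputable def coordY : 𝒪 := germSnd id analyticAt_id

theorem coordY_pow (d : ℕ) : coordY ^ d = germSnd (fun y => y ^ d) (analyticAt_id.pow d) := by
  induction d with
  | zero => rfl
  | succ d ih =>
    rw [pow_succ, ih, coordY, germSnd, germSnd, germOf_mul]
    exact germOf_eq_iff.2 (Eventually.of_forall fun q => (pow_succ q.2 d).symm)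

theorem isUnit_germOf {F : ℂ × ℂ → ℂ} (hF : AnalyticAt ℂ F 0) (h0 : F 0 ≠ 0) :
    IsUnit (germOf F hF) := by
  refine IsUnit.of_mul_eq_one (germOf (fun q => (F q)⁻¹) (hF.inv h0)) ?_
  rw [germOf_mul, ← germOf_one, germOf_eq_iff]
  filter_upwards [hF.continuousAt.eventually_ne h0] with q hq using mul_inv_cancel₀ hq

theorem not_isUnit_coordX : ¬ IsUnit coordX := by
  intro h
  obtain ⟨g, hg⟩ := h.exists_right_inv
  obtain ⟨G, hG, rfl⟩ := exists_germOf g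
  rw [coordX, germOf_mul, ← germOf_one, germOf_eq_iff] at hg
  simpa using hg.eq_of_nhds

/-- The order of vanishing at the origin of the restriction `h(0, y)` of a germ to the line `x = 0`;
it is `⊤` when this restriction is zero. It is read off from a chosen representative, the choice being
immaterial by `orderY_germOf`. -/
noncomputable def orderY (h : 𝒪) : ℕ∞ :=
  analyticOrderAt (fun y => (exists_germOf h).choose (0, y)) 0

theorem orderY_germOf {F : ℂ × ℂ → ℂ} (hF : AnalyticAt ℂ F 0) :
    orderY (germOf F hF) = analyticOrderAt (fun y => F (0, y)) 0 := by
  refine analyticOrderAt_congr ?_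
  obtain ⟨hG, e⟩ := (exists_germOf (germOf F hF)).choose_spec
  exact ((Continuous.prodMk_right (0 : ℂ)).tendsto' 0 0 rfl).eventually (germOf_eq_iff.1 e)

theorem analyticAt_restrict {F : ℂ × ℂ → ℂ} {y : ℂ} (hF : AnalyticAt ℂ F (0, y)) :
    AnalyticAt ℂ (fun y => F (0, y)) y :=
  AnalyticAt.comp (f := fun y : ℂ => ((0 : ℂ), y)) hF (analyticAt_const.prod analyticAt_id)

/-- Hadamard's lemma in the variable `x`. -/
theorem germOf_eq_germSnd_add {F : ℂ × ℂ → ℂ} (hF : AnalyticAt ℂ F 0) :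
    ∃ h : 𝒪, germOf F hF = germSnd (fun y => F (0, y)) (analyticAt_restrict hF) + coordX * h := by
  refine ⟨germOf _ (analyticAt_dslope_fst (x₀ := 0) (y₀ := 0) hF), ?_⟩
  rw [germSnd, coordX, germOf_mul, germOf_add, germOf_eq_iff]
  refine Eventually.of_forall fun q => ?_
  have := sub_smul_dslope (fun x => F (x, q.2)) 0 q.1
  simp only [sub_zero, smul_eq_mul] at this
  show F q = F (0, q.2) + q.1 * dslope (fun x => F (x, q.2)) 0 q.1
  rw [this]
  ring

theorem coordX_dvd_of_orderY_eq_top {h : 𝒪} (hh : orderY h = ⊤) : coordX ∣ h := by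
  obtain ⟨F, hF, rfl⟩ := exists_germOf h
  rw [orderY_germOf, analyticOrderAt_eq_top] at hh
  obtain ⟨h₁, e⟩ := germOf_eq_germSnd_add hF
  refine ⟨h₁, ?_⟩
  rw [e, add_eq_right, germSnd, ← germOf_zero, germOf_eq_iff]
  exact (continuous_snd.tendsto' (0 : ℂ × ℂ) 0 rfl).eventually hh

theorem exists_eq_pow_mul_add_of_orderY_ne_top {h : 𝒪} (hh : orderY h ≠ ⊤) :
    ∃ (d : ℕ) (u h₁ : 𝒪), IsUnit u ∧ h = coordY ^ d * u + coordX * h₁ := by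
  obtain ⟨F, hF, rfl⟩ := exists_germOf h
  rw [orderY_germOf] at hh
  obtain ⟨d, hd⟩ := ENat.ne_top_iff_exists.1 hh
  obtain ⟨u, hu, u0, eu⟩ := ((analyticAt_restrict hF).analyticOrderAt_eq_natCast).1 hd.symm
  obtain ⟨h₁, e⟩ := germOf_eq_germSnd_add hF
  refine ⟨d, germSnd u hu, h₁, isUnit_germOf _ u0, ?_⟩
  rw [e, add_left_inj]
  rw [coordY_pow, germSnd, germSnd, germSnd, germOf_mul, germOf_eq_iff]
  have := (continuous_snd.tendsto' (0 : ℂ × ℂ) 0 rfl).eventually eu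
  filter_upwards [this] with q hq
  simpa using hq

/-- Hadamard's lemma: a germ is a constant modulo `(x, y)`. -/
theorem exists_eq_const_add (h : 𝒪) :
    ∃ (c : ℂ) (h₁ h₂ : 𝒪), h = algebraMap ℂ 𝒪 c + coordX * h₁ + coordY * h₂ := by
  obtain ⟨F, hF, rfl⟩ := exists_germOf h
  obtain ⟨h₁, e⟩ := germOf_eq_germSnd_add hF
  have hd : AnalyticAt ℂ (dslope (fun y => F (0, y)) 0) 0 := by
    obtain ⟨p, hp⟩ := analyticAt_restrict hF
    exact ⟨_, hp.has_fpower_series_dslope_fslope⟩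
  refine ⟨F 0, h₁, germSnd _ hd, ?_⟩
  rw [e, add_right_comm, add_left_inj, algebraMap_eq_germOf, coordY, germSnd, germSnd, germSnd,
    germOf_mul, germOf_add, germOf_eq_iff]
  refine Eventually.of_forall fun q => ?_
  have := sub_smul_dslope (fun y => F (0, y)) 0 q.2
  simp only [sub_zero, smul_eq_mul] at this
  show F (0, q.2) = F 0 + q.2 * dslope (fun y => F (0, y)) 0 q.2
  rw [this]
  exact (add_sub_cancel _ _).symm

/-! ### Division by an element of minimal order -/

/-- Suppose that `I` is an ideal of germs with `x h ∈ I → h ∈ I`, that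
`P` represents an element of `I` whose order on the line `x = 0` is minimal, and that `P` vanishes on
the disc `{0} × {|y| ≤ s}` at most at its centre. For a representative `F` of an element of `I`
the candidate quotient is the Cauchy transform `T F` of `F / P` on the circle `|y| = s`. By
minimality of the order, `F = c(y) P + x F₁` with `c` analytic, where `F₁` again represents an
element of `I`; then `T F = c + x T F₁`, and so `F - P T F = x (F₁ - P T F₁)`. Iterating, `F - P T F`
is divisible by every power of `x`. -/
theorem sub_mul_cauchyTransform_eq_pow_mul {I : Ideal 𝒪} (sat : ∀ h, coordX * h ∈ I → h ∈ I)
    {P : ℂ × ℂ → ℂ} {s : NNReal} (hs : 0 < s)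
    (hP : ∀ y ∈ Metric.closedBall (0 : ℂ) s, AnalyticAt ℂ P (0, y))
    (hP0 : ∀ y ∈ Metric.closedBall (0 : ℂ) s, y ≠ 0 → P (0, y) ≠ 0)
    (hPI : ∃ hP' : AnalyticAt ℂ P 0, germOf P hP' ∈ I ∧ orderY (germOf P hP') ≠ ⊤ ∧
      ∀ h ∈ I, orderY (germOf P hP') ≤ orderY h)
    {Ψ : ℂ → C(Metric.sphere (0 : ℂ) s, ℂ)} (hΨ : AnalyticAt ℂ Ψ 0)
    (hΨP : ∀ᶠ x in 𝓝 0, ∀ ζ : Metric.sphere (0 : ℂ) s, Ψ x ζ = P (x, ζ)) (hΨu : IsUnit (Ψ 0))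
    (N : ℕ) {F : ℂ × ℂ → ℂ} (hF : ∀ y ∈ Metric.closedBall (0 : ℂ) s, AnalyticAt ℂ F (0, y))
    (hFI : ∃ hF' : AnalyticAt ℂ F 0, germOf F hF' ∈ I)
    {Φ : ℂ → C(Metric.sphere (0 : ℂ) s, ℂ)} (hΦ : AnalyticAt ℂ Φ 0)
    (hΦF : ∀ᶠ x in 𝓝 0, ∀ ζ : Metric.sphere (0 : ℂ) s, Φ x ζ = F (x, ζ)) :
    ∃ W : ℂ × ℂ → ℂ, AnalyticAt ℂ W 0 ∧ ∀ᶠ q in 𝓝 (0 : ℂ × ℂ),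
      F q - P q * cauchyTransform 0 s q.2 (Φ q.1 * Ring.inverse (Ψ q.1)) = q.1 ^ N * W q := by
  obtain ⟨hP', hPI, hPt, hPmin⟩ := hPI
  have h0 : (0 : ℂ) ∈ Metric.closedBall (0 : ℂ) s := Metric.mem_closedBall_self s.2
  have h0' : (0 : ℂ) ∈ Metric.ball (0 : ℂ) s := Metric.mem_ball_self hs
  have hinv : AnalyticAt ℂ (fun x => Ring.inverse (Ψ x)) 0 := analyticAt_ringInverse_comp hΨ hΨu
  induction N generalizing F Φ with
  | zero =>
    obtain ⟨hF', -⟩ := hFI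
    exact ⟨_, hF'.sub (hP'.mul (analyticAt_cauchyTransform (hΦ.mul hinv) h0')), by simp⟩
  | succ N ih =>
    obtain ⟨hF', hFI⟩ := hFI
    obtain ⟨c, hc, hcP⟩ := exists_analytic_quotient (f := fun y => F (0, y))
      (g := fun y => P (0, y)) h0 (fun y hy => analyticAt_restrict (hF y hy))
      (fun y hy => analyticAt_restrict (hP y hy)) hP0
      (by rwa [← orderY_germOf hP'])
      (by rw [← orderY_germOf hP', ← orderY_germOf hF']; exact hPmin _ hFI)
    -- `F₁ = (F - c P) / x`, extended by the derivative in `x` on the line `x = 0`.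
    let F₁ : ℂ × ℂ → ℂ := fun q => dslope (fun x => F (x, q.2) - c q.2 * P (x, q.2)) 0 q.1
    have hF₁ (y : ℂ) (hy : y ∈ Metric.closedBall (0 : ℂ) s) : AnalyticAt ℂ F₁ (0, y) :=
      analyticAt_dslope_fst (F := fun q => F q - c q.2 * P q) ((hF y hy).sub
        ((AnalyticAt.comp (f := Prod.snd) (x := ((0, y) : ℂ × ℂ)) (hc y hy) analyticAt_snd).mul
          (hP y hy)))
    have split (x y : ℂ) (hy : y ∈ Metric.closedBall (0 : ℂ) s) :
        F (x, y) = c y * P (x, y) + x * F₁ (x, y) := by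
      have := sub_smul_dslope (fun x => F (x, y) - c y * P (x, y)) 0 x
      simp only [sub_zero, smul_eq_mul, hcP y hy, sub_self] at this
      simp only [F₁, this]
      ring
    have near : ∀ᶠ q : ℂ × ℂ in 𝓝 0, q.2 ∈ Metric.ball (0 : ℂ) s :=
      (continuous_snd.tendsto' (0 : ℂ × ℂ) 0 rfl).eventually (Metric.ball_mem_nhds 0 hs)
    have hF₁' : AnalyticAt ℂ F₁ 0 := hF₁ 0 h0
    have hF₁I : germOf F₁ hF₁' ∈ I := by
      have e : germOf F hF' = germSnd c (hc 0 h0) * germOf P hP' + coordX * germOf F₁ hF₁' := by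
        rw [germSnd, coordX, germOf_mul, germOf_mul, germOf_add, germOf_eq_iff]
        filter_upwards [near] with q hq using split q.1 q.2 (Metric.ball_subset_closedBall hq)
      refine sat _ ?_
      rw [← add_sub_cancel_left (germSnd c (hc 0 h0) * germOf P hP') (coordX * _), ← e]
      exact I.sub_mem hFI (I.mul_mem_left _ hPI)
    obtain ⟨Φ₁, hΦ₁, hΦ₁F⟩ := exists_analyticAt_curry (K := Metric.sphere (0 : ℂ) s) (x₀ := 0)
      fun y hy => hF₁ y (Metric.sphere_subset_closedBall hy)
    obtain ⟨W, hW, e⟩ := ih hF₁ ⟨hF₁', hF₁I⟩ hΦ₁ hΦ₁F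
    refine ⟨W, hW, ?_⟩
    have hcd : DifferentiableOn ℂ c (Metric.closedBall 0 s) := fun y hy =>
      (hc y hy).differentiableAt.differentiableWithinAt
    -- On the circle, `F / P = c + x F₁ / P` as curves in the Banach algebra of continuous functions.
    let C : C(Metric.sphere (0 : ℂ) s, ℂ) :=
      ⟨fun ζ => c ζ, (hcd.continuousOn.mono Metric.sphere_subset_closedBall).domRestrict⟩
    have curves : ∀ᶠ x in 𝓝 0, Φ x * Ring.inverse (Ψ x) =
        C + x • (Φ₁ x * Ring.inverse (Ψ x)) := by
      filter_upwards [hΦF, hΨP, hΦ₁F,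
        hΨ.continuousAt.eventually (Units.isOpen.mem_nhds hΨu)] with x h1 h2 h3 hu
      have : Φ x = C * Ψ x + x • Φ₁ x := by
        ext ζ
        simp only [ContinuousMap.add_apply, ContinuousMap.mul_apply, ContinuousMap.smul_apply,
          h1, h2, h3, smul_eq_mul]
        exact split x ζ (Metric.sphere_subset_closedBall ζ.2)
      rw [this, add_mul, mul_assoc, Ring.mul_inverse_cancel _ hu, mul_one, smul_mul_assoc]
    filter_upwards [near, e, (continuous_fst.tendsto' (0 : ℂ × ℂ) 0 rfl).eventually curves]
      with q hq e hcur
    rw [hcur, map_add, map_smul, cauchyTransform_eq hq hcd (g := C) (fun _ => rfl), pow_succ',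
      mul_assoc, ← e, smul_eq_mul, show F q = c q.2 * P q + q.1 * F₁ q from
        split q.1 q.2 (Metric.ball_subset_closedBall hq)]
    ring

/-- In an ideal `I` of germs with `x h ∈ I → h ∈ I`, an element of minimal order on the line `x = 0`
divides all the others. -/
theorem dvd_of_orderY_minimal {I : Ideal 𝒪} (sat : ∀ h, coordX * h ∈ I → h ∈ I) {p : 𝒪}
    (hp : p ∈ I) (hpt : orderY p ≠ ⊤) (hmin : ∀ h ∈ I, orderY p ≤ orderY h) :
    ∀ h ∈ I, p ∣ h := by
  intro h hh
  obtain ⟨P, hP, rfl⟩ := exists_germOf p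
  obtain ⟨F, hF, rfl⟩ := exists_germOf h
  have along {G : ℂ × ℂ → ℂ} (hG : AnalyticAt ℂ G 0) : ∀ᶠ y : ℂ in 𝓝 0, AnalyticAt ℂ G (0, y) :=
    ((Continuous.prodMk_right (0 : ℂ)).tendsto' 0 0 rfl).eventually hG.eventually_analyticAt
  have hne : ∀ᶠ y : ℂ in 𝓝 0, y ≠ 0 → P (0, y) ≠ 0 := by
    rw [orderY_germOf, ne_eq, analyticOrderAt_eq_top] at hpt
    exact eventually_nhdsWithin_iff.1
      ((analyticAt_restrict hP).eventually_eq_zero_or_eventually_ne_zero.resolve_left hpt)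
  obtain ⟨s', hs, hball⟩ := Metric.nhds_basis_closedBall.mem_iff.1
    ((along hP).and ((along hF).and hne))
  lift s' to NNReal using hs.le with s
  replace hs : 0 < s := hs
  obtain ⟨Ψ, hΨ, hΨP⟩ := exists_analyticAt_curry (K := Metric.sphere (0 : ℂ) s) (x₀ := 0)
    fun y hy => (hball (Metric.sphere_subset_closedBall hy)).1
  obtain ⟨Φ, hΦ, hΦF⟩ := exists_analyticAt_curry (K := Metric.sphere (0 : ℂ) s) (x₀ := 0)
    fun y hy => (hball (Metric.sphere_subset_closedBall hy)).2.1
  have hΨu : IsUnit (Ψ 0) := by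
    rw [ContinuousMap.isUnit_iff_forall_ne_zero]
    intro ζ
    rw [hΨP.self_of_nhds ζ]
    exact (hball (Metric.sphere_subset_closedBall ζ.2)).2.2
      (ne_zero_of_mem_sphere (NNReal.coe_ne_zero.2 hs.ne') ζ)
  have hQ : AnalyticAt ℂ (fun q : ℂ × ℂ =>
      cauchyTransform 0 s q.2 (Φ q.1 * Ring.inverse (Ψ q.1))) 0 :=
    analyticAt_cauchyTransform (Φ := fun x => Φ x * Ring.inverse (Ψ x))
      (hΦ.mul (analyticAt_ringInverse_comp hΨ hΨu)) (Metric.mem_ball_self hs)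
  refine ⟨germOf _ hQ, ?_⟩
  rw [germOf_mul, germOf_eq_iff]
  have := eventually_eq_zero_of_forall_pow_fst (hF.sub (hP.mul hQ)) fun N =>
    sub_mul_cauchyTransform_eq_pow_mul sat hs (fun y hy => (hball hy).1)
      (fun y hy => (hball hy).2.2) ⟨hP, hp, hpt, hmin⟩ hΨ hΨP hΨu N (fun y hy => (hball hy).2.1)
      ⟨hF, hh⟩ hΦ hΦF
  exact this.mono fun q hq => sub_eq_zero.1 hq

/-! ### Ideals generated by germs without common factor -/

/-- The saturation `⋃ₙ (J : xⁿ)` of an ideal with respect to an element `x`. -/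
def saturation {R : Type*} [CommRing R] (J : Ideal R) (x : R) : Ideal R where
  carrier := {h | ∃ n : ℕ, x ^ n * h ∈ J}
  add_mem' := by
    rintro h k ⟨m, hm⟩ ⟨n, hn⟩
    refine ⟨m + n, ?_⟩
    have : x ^ (m + n) * (h + k) = x ^ n * (x ^ m * h) + x ^ m * (x ^ n * k) := by ring
    rw [this]
    exact J.add_mem (J.mul_mem_left _ hm) (J.mul_mem_left _ hn)
  zero_mem' := ⟨0, by simp⟩
  smul_mem' := by
    rintro c h ⟨n, hn⟩
    refine ⟨n, ?_⟩
    have : x ^ n * (c • h) = c * (x ^ n * h) := by rw [smul_eq_mul]; ring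
    rw [this]
    exact J.mul_mem_left _ hn

/-- If `a` and `b` have no common factor, then `(a, b)` contains a power of `x` and a power of `y`.
A generator of the saturation of `(a, b)` with respect to `x` is a common factor of `a` and `b`,
hence a unit, which yields the power of `x`. As `a` and `b` are not both divisible by `x`, one of
them is of the form `yᵈ · unit + x · (…)`, which yields the power of `y`. -/
theorem exists_pow_mem_span_pair {a b : 𝒪} (hab : IsRelPrime a b) :
    (∃ n : ℕ, coordX ^ n ∈ Ideal.span {a, b}) ∧ ∃ n : ℕ, coordY ^ n ∈ Ideal.span {a, b} := by
  set J : Ideal 𝒪 := Ideal.span {a, b}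
  have ha : a ∈ J := Ideal.subset_span (by simp)
  have hb : b ∈ J := Ideal.subset_span (by simp)
  obtain ⟨g, hg, hgt⟩ : ∃ g ∈ J, orderY g ≠ ⊤ := by
    by_contra! H
    exact not_isUnit_coordX (hab (coordX_dvd_of_orderY_eq_top (H a ha))
      (coordX_dvd_of_orderY_eq_top (H b hb)))
  have hJ : J ≤ saturation J coordX := fun h hh => ⟨0, by simpa using hh⟩
  obtain ⟨n, hn⟩ : ∃ n : ℕ, coordX ^ n ∈ J := by
    obtain ⟨p, hp, hmin⟩ : ∃ p ∈ saturation J coordX, ∀ h ∈ saturation J coordX,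
        orderY p ≤ orderY h := by
      obtain ⟨p, hp, hmin⟩ := (InvImage.wf orderY wellFounded_lt).has_min
        (saturation J coordX : Set 𝒪) ⟨g, hJ hg⟩
      exact ⟨p, hp, fun h hh => not_lt.1 (hmin h hh)⟩
    have hdvd := dvd_of_orderY_minimal (I := saturation J coordX)
      (fun h ⟨n, hn⟩ => ⟨n + 1, by rwa [pow_succ, mul_assoc]⟩) hp
      (ne_top_of_le_ne_top hgt (hmin g (hJ hg))) hmin
    have hu : IsUnit p := hab (hdvd a (hJ ha)) (hdvd b (hJ hb))
    have one : (1 : 𝒪) ∈ saturation J coordX :=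
      (Ideal.eq_top_iff_one _).1 (Ideal.eq_top_of_isUnit_mem _ hp hu)
    obtain ⟨n, hn⟩ := one
    exact ⟨n, by simpa using hn⟩
  refine ⟨⟨n, hn⟩, ?_⟩
  obtain ⟨d, u, h₁, ⟨u, rfl⟩, rfl⟩ := exists_eq_pow_mul_add_of_orderY_ne_top hgt
  refine ⟨d * n, ?_⟩
  have hx : Ideal.Quotient.mk J coordX ^ n = 0 := by
    rw [← map_pow]; exact Ideal.Quotient.eq_zero_iff_mem.2 hn
  have hy : Ideal.Quotient.mk J coordY ^ d =
      Ideal.Quotient.mk J coordX * Ideal.Quotient.mk J (-(h₁ * ↑u⁻¹)) := by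
    rw [← map_pow, ← map_mul, Ideal.Quotient.eq]
    convert J.mul_mem_left (↑u⁻¹ : 𝒪) hg using 1
    linear_combination (-coordY ^ d) * u.inv_mul
  rw [← Ideal.Quotient.eq_zero_iff_mem, map_pow, pow_mul, hy, mul_pow, hx, zero_mul]

/-- The quotient of `𝒪` by two germs without common factor has finite dimension. -/
theorem finite_quotient_span_pair {a b : 𝒪} (hab : IsRelPrime a b) :
    Module.Finite ℂ (𝒪 ⧸ Ideal.span {a, b}) := by
  obtain ⟨⟨m, hm⟩, n, hn⟩ := exists_pow_mem_span_pair hab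
  refine finite_of_isNilpotent (X := Ideal.Quotient.mk _ coordX) (Y := Ideal.Quotient.mk _ coordY)
    ⟨m, ?_⟩ ⟨n, ?_⟩ fun h => ?_
  · rw [← map_pow]; exact Ideal.Quotient.eq_zero_iff_mem.2 hm
  · rw [← map_pow]; exact Ideal.Quotient.eq_zero_iff_mem.2 hn
  · obtain ⟨h, rfl⟩ := Ideal.Quotient.mk_surjective h
    obtain ⟨c, h₁, h₂, rfl⟩ := exists_eq_const_add h
    exact ⟨c, Ideal.Quotient.mk _ h₁, Ideal.Quotient.mk _ h₂, by simp only [map_add, map_mul]; rfl⟩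

/-! ### First-order unfoldings -/

theorem mem_idealI_iff {η : OneForm} {h : 𝒪} : h ∈ idealI η ↔ h * η.d.f ∈ idealJ η := by
  rw [idealJ, Ideal.mem_span_pair]
  constructor
  · rintro ⟨θ, hθ⟩
    have h1 : h * η.d.f = η.a * θ.b - η.b * θ.a := congrArg TwoForm.f hθ
    exact ⟨θ.b, -θ.a, by linear_combination -h1⟩
  · rintro ⟨u, v, e⟩
    refine ⟨⟨-v, u⟩, TwoForm.ext ?_⟩
    show h * η.d.f = η.a * u - η.b * -v
    linear_combination -e

theorem idealJd_eq_sup (η : OneForm) : idealJd η = idealJ η ⊔ Ideal.span {η.d.f} := by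
  rw [idealJd, idealJ, ← Ideal.span_union]
  congr 1
  ext z
  simp
  tauto

end PlaneFoliation

/-- For every germ of holomorphic 1-form `η` defining a germ of foliation on `(ℂ², 0)`, the
number `δ` is finite, it is the complex dimension of `𝒪 / J(η, dη)`, and the space of
first-order unfoldings `I(η)/J(η)` has length, and complex dimension, equal to `δ`. -/
theorem mainTheorem3 (η : PlaneFoliation.OneForm) (hη : η.DefinesFoliation) :
    Module.Finite ℂ (PlaneFoliation.𝒪 ⧸ PlaneFoliation.idealJd η) ∧
    PlaneFoliation.delta η =
      (Module.finrank ℂ (PlaneFoliation.𝒪 ⧸ PlaneFoliation.idealJd η) : ℕ∞) ∧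
    Module.length PlaneFoliation.𝒪 (PlaneFoliation.Unfoldings η) = PlaneFoliation.delta η ∧
    Module.Finite ℂ (PlaneFoliation.Unfoldings η) ∧
    (Module.finrank ℂ (PlaneFoliation.Unfoldings η) : ℕ∞) = PlaneFoliation.delta η := by
  have : Module.Finite ℂ (PlaneFoliation.𝒪 ⧸ PlaneFoliation.idealJ η) :=
    PlaneFoliation.finite_quotient_span_pair hη
  obtain ⟨fin, finU, e⟩ := finrank_colon_quotient (k := ℂ)
    (fun _ => PlaneFoliation.mem_idealI_iff) (PlaneFoliation.idealJd_eq_sup η)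
  have hδ : PlaneFoliation.delta η =
      (Module.finrank ℂ (PlaneFoliation.𝒪 ⧸ PlaneFoliation.idealJd η) : ℕ∞) :=
    length_eq_finrank_of_isAlgClosed
  have hU : Module.length PlaneFoliation.𝒪 (PlaneFoliation.Unfoldings η) =
      (Module.finrank ℂ (PlaneFoliation.Unfoldings η) : ℕ∞) := length_eq_finrank_of_isAlgClosed
  exact ⟨fin, hδ, by rw [hU, hδ, e], finU, by rw [hδ, e]⟩
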